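/- Setting. Let $\mathcal Y$ be a finite set, $\mathcal D\subseteq\mathbb R^n$, and let $\Sigma$ be the deterministic system $x_{k+1}=f(x_k)$, $y_k=h(x_k)\in\mathcal Y$, $x_0\in\mathcal D$. Assume that $\Sigma$ is non-blocking on $\mathcal D$, i.e. $f(\mathcal D)\subseteq\mathcal D$. Let $\mathcal P$ be a probability measure on $\mathcal D$ for which all the classes $[\mathtt y]=\{x\in\mathcal D: h(f^{j-1}(x))=\mathtt y(j),\ 1\le j\le l\}$, $\mathtt y\in\mathcal Y^l$, $l\ge 0$, are events. The embedding $\mathcal S$ of $\Sigma$ is the transition system with state set $\mathcal D$, all states initial, edges $(x,f(x))$ and output map $h$. For a transition system $\mathcal T$, $\mathcal B^\omega(\mathcal T)$ is the set of output sequences of its infinite runs that start in an initial state, and $\mathcal B^\omega(\mathcal T(x))$ is the set of those of the runs that start in the state $x$. $\mathcal T$ is called deterministic (non-blocking) if every state has at most (at least) one outgoing edge. Let $\ell\ge 1$. For $W\subseteq\mathcal Y^{\ell}$ consider transition systems with state set $W$, edges $(k\sigma,\sigma k')$ for all $k\sigma,\sigma k'\in W$ with $k,k'\in\mathcal Y$,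 $\sigma\in\mathcal Y^{\ell-1}$, and output $k$ at the state $k\sigma$. The strongest $\ell$-complete abstraction $\mathcal S_{\ell}$ of $\mathcal S$ is the one in which $W$ is the set of all contiguous subsequences of length $\ell$ of sequences in $\mathcal B^\omega(\mathcal S)$, its initial states being the $\ell$-long output sequences of $\mathcal S$ from its initial states. Given $N$ initial states $x_{0,1},\dots,x_{0,N}$ drawn independently from $\mathcal P$, the data-driven abstraction $\mathcal S_{\ell}^N$ is the one in which $W$ is the set of the $\ell$-sequences that occur as contiguous subsequences of at least one of the $N$ output trajectories of length $H$ started at the $x_{0,i}$, all states being initial (no states are added to it artificially). Let $\delta_i\in\{0,1\}^{\mathcal Y^{\ell}}$ be the indicator vector of the $\ell$-sequences that occur in the $i$-th trajectory, and consider the scenario program $\min_{\theta\in\mathbb R^{\mathcal Y^{\ell}}}\mathbf 1^{T}\theta$ subject to $\theta\ge\delta_i$, $i=1,\dots,N$. Its complexity $s_N^*$ is the least cardinality of a subset of the $N$ constraints for which the program has the same solution (and $s^*_0=0$). For $\beta\in(0,1)$ put $\epsilon(s,\beta,N)=1-t$ for $0\le s<N$, where $t$ is the unique root in $(0,1)$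 of $$\binom{N}{s}t^{N-s}-\frac{\beta}{N}\sum_{m=s}^{N-1}\binom{m}{s}t^{m-s}=0,$$ and $\epsilon(N,\beta,N)=1$. Write $\bar\epsilon=\epsilon(s_N^*,\beta,N)$. Proposition. Suppose that $\mathcal S_{\bar\ell}$ is deterministic for some $\bar\ell\ge 1$ (in particular, the partition of $\mathcal D$ into the classes of $\bar\ell$-sequences is then a bisimulation on $\mathcal S$). Take $\ell=\bar\ell$ above, and let $N\ge 0$ and $\beta\in(0,1)$. (1) If $H=|\mathcal Y|^{\bar\ell-1}+\bar\ell-1$, then $$\mathcal P^N\Big[\,\mathcal P\big[x_0:\ \mathcal B^\omega(\mathcal S(x_0))\subseteq\mathcal B^\omega(\mathcal S_{\bar\ell}^N)\big]\ \ge\ 1-\bar\epsilon\,\Big]\ \ge\ 1-\beta .$$ (2) If $\bar\ell\le H<|\mathcal Y|^{\bar\ell-1}+\bar\ell-1$, then the same guarantee holds for non-blocking data-driven abstractions: with $\mathcal P^N$-probability at least $1-\beta$, if $\mathcal S_{\bar\ell}^N$ is non-blocking, then $\mathcal P[x_0:\ \mathcal B^\omega(\mathcal S(x_0))\subseteq\mathcal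 B^\omega(\mathcal S_{\bar\ell}^N)]\ge 1-\bar\epsilon$. -/

import Mathlib

open MeasureTheory

/-! ### Sequences -/

/-- The finite sequence `r` exhibits the finite sequence `p` as a contiguous subsequence. -/
def Exhibits {Y : Type*} {m l : ℕ} (r : Fin m → Y) (p : Fin l → Y) : Prop :=
  ∃ k : ℕ, ∃ hk : k + l ≤ m, ∀ i : Fin l, r ⟨k + i, by omega⟩ = p i

/-- The infinite sequence `r` exhibits the finite sequence `p` as a contiguous subsequence. -/
def ExhibitsInf {Y : Type*} {l : ℕ} (r : ℕ → Y) (p : Fin l → Y) : Prop :=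
  ∃ k : ℕ, ∀ i : Fin l, r (k + i) = p i

/-! ### Transition systems -/

/-- A transition system with state set `X` and output set `Y`. -/
structure TransitionSystem (X Y : Type*) where
  /-- the initial states -/
  init : Set X
  /-- the transitions -/
  edge : X → X → Prop
  /-- the output map -/
  out : X → Y

namespace TransitionSystem

variable {X Y : Type*}

/-- Every state has at least one outgoing transition. -/
def NonBlocking (S : TransitionSystem X Y) : Prop := ∀ x, ∃ x', S.edge x x'

/-- Every state has at most one outgoing transition. -/
def Deterministic (S : TransitionSystem X Y) : Prop :=
  ∀ x x' x'', S.edge x x' → S.edge x x'' → x' = x''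

/-- The infinite external behaviours of `S` starting from the state `x`. -/
def behavioursFrom (S : TransitionSystem X Y) (x : X) : Set (ℕ → Y) :=
  {y | ∃ r : ℕ → X, r 0 = x ∧ (∀ i, S.edge (r i) (r (i + 1))) ∧ ∀ i, S.out (r i) = y i}

/-- The infinite external behaviours of `S`. -/
def behaviours (S : TransitionSystem X Y) : Set (ℕ → Y) :=
  {y | ∃ x ∈ S.init, y ∈ S.behavioursFrom x}

/-- The finite external behaviours of `S` of length `H`. -/
def finiteBehaviours (S : TransitionSystem X Y) (H : ℕ) : Set (Fin H → Y) :=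
  {y | ∃ r : Fin H → X, (∀ i : Fin H, (i : ℕ) = 0 → r i ∈ S.init) ∧
    (∀ i j : Fin H, (j : ℕ) = i + 1 → S.edge (r i) (r j)) ∧ ∀ i, S.out (r i) = y i}

/-- The transition system whose states are the `ℓ`-sequences in `W`, with the domino rule
`kσ → σk'` as transition relation and the first letter of a state as its output. -/
def domino {ℓ : ℕ} [NeZero ℓ] (W : Set (Fin ℓ → Y)) (I : Set W) : TransitionSystem W Y where
  init := I
  edge a b := ∀ i j : Fin ℓ, (j : ℕ) = i + 1 → a.1 j = b.1 i
  out a := a.1 0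

/-- The set of all `ℓ`-long subsequences of all (infinite) behaviours of `S`. -/
def subsequences (S : TransitionSystem X Y) (ℓ : ℕ) : Set (Fin ℓ → Y) :=
  {w | ∃ y ∈ S.behaviours, ExhibitsInf y w}

/-- The strongest `ℓ`-complete abstraction of `S`. -/
def strongestComplete (S : TransitionSystem X Y) (ℓ : ℕ) [NeZero ℓ] :
    TransitionSystem (S.subsequences ℓ) Y :=
  domino (S.subsequences ℓ) {w | w.1 ∈ S.finiteBehaviours ℓ}

end TransitionSystem

/-! ### Concrete systems -/

/-- A time-invariant system `x (k+1) = f (x k)`, `y k = h (x k)` on the domain `D ⊆ ℝⁿ`. -/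
structure OutputSystem (n : ℕ) (Y : Type*) where
  /-- the domain -/
  D : Set (EuclideanSpace ℝ (Fin n))
  /-- the flow -/
  f : EuclideanSpace ℝ (Fin n) → EuclideanSpace ℝ (Fin n)
  /-- the output map -/
  h : EuclideanSpace ℝ (Fin n) → Y

namespace OutputSystem

variable {n : ℕ} {Y : Type*}

/-- The embedding of the system: a transition system with state set `D`. -/
def embedding (S : OutputSystem n Y) : TransitionSystem S.D Y where
  init := Set.univ
  edge x x' := (x' : EuclideanSpace ℝ (Fin n)) = S.f x
  out x := S.h x

/-- The output trajectory over the time interval `[0, H-1]` started at `x`. -/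
def trajectory (S : OutputSystem n Y) (H : ℕ) (x : S.D) : Fin H → Y :=
  fun j => S.h (S.f^[j] x)

/-- The equivalence class `[y]` of an output sequence `y`. -/
def eqClass (S : OutputSystem n Y) {l : ℕ} (y : Fin l → Y) : Set S.D :=
  {x | ∀ j, y j = S.h (S.f^[j] x)}

/-- The `ℓ`-sequences witnessed in the `N` trajectories of length `H` started at the points `x`. -/
def witnessed (S : OutputSystem n Y) (ℓ H : ℕ) {N : ℕ} (x : Fin N → S.D) : Set (Fin ℓ → Y) :=
  {w | ∃ i, Exhibits (S.trajectory H (x i)) w}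

/-- The data-driven `ℓ`-complete abstraction; all its states are initial. -/
def dataDriven (S : OutputSystem n Y) (ℓ H : ℕ) [NeZero ℓ] {N : ℕ} (x : Fin N → S.D) :
    TransitionSystem (S.witnessed ℓ H x) Y :=
  TransitionSystem.domino (S.witnessed ℓ H x) Set.univ

open Classical in
/-- The scenario associated with the initial state `x`: the 0-1 vector, indexed by the
`ℓ`-sequences, that marks those exhibited by the trajectory of length `H` started at `x`. -/
noncomputable def scenario (S : OutputSystem n Y) (ℓ H : ℕ) (x : S.D) : (Fin ℓ → Y) → ℝ :=
  fun w => if Exhibits (S.trajectory H x) w then 1 else 0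

/-- The probability, for `x₀ ∼ P`, that all infinite behaviours of the embedding started at `x₀`
are behaviours of `T`. -/
noncomputable def inclusionProb (S : OutputSystem n Y) (P : Measure S.D) {Z : Type*}
    (T : TransitionSystem Z Y) : ℝ :=
  P.real {x₀ | S.embedding.behavioursFrom x₀ ⊆ T.behaviours}

end OutputSystem

/-! ### The scenario program -/

/-- `θ` solves the program `min 1ᵀθ` subject to `θ ≥ δ i` for `i ∈ I`. -/
def IsScenarioSolution {ι : Type*} [Fintype ι] {N : ℕ} (δ : Fin N → ι → ℝ) (I : Finset (Fin N))
    (θ : ι → ℝ) : Prop :=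
  (∀ i ∈ I, δ i ≤ θ) ∧ ∀ θ' : ι → ℝ, (∀ i ∈ I, δ i ≤ θ') → ∑ j, θ j ≤ ∑ j, θ' j

/-- The complexity `s*`: the least number of scenarios that yield the same solution as all of
them. -/
noncomputable def complexity {ι : Type*} [Fintype ι] {N : ℕ} (δ : Fin N → ι → ℝ) : ℕ :=
  sInf {m | ∃ I : Finset (Fin N), I.card = m ∧
    ∃ θ, IsScenarioSolution δ I θ ∧ IsScenarioSolution δ Finset.univ θ}

/-- The polynomial equation, in the variable `t`, of the scenario bound at complexity `s < N`. -/
def ScenarioEquation (s : ℕ) (β : ℝ) (N : ℕ) (t : ℝ) : Prop :=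
  (N.choose s : ℝ) * t ^ (N - s) - β / N * ∑ m ∈ Finset.Ico s N, (m.choose s : ℝ) * t ^ (m - s) = 0

/-- The scenario bound `ε(s, β, N)`: it is `1 - t`, with `t` the unique root in `(0, 1)` of the
polynomial equation, if `s < N`, and `1` otherwise. -/
noncomputable def scenarioBound (s : ℕ) (β : ℝ) (N : ℕ) : ℝ :=
  if s < N then 1 - sSup {t : ℝ | 0 < t ∧ t < 1 ∧ ScenarioEquation s β N t} else 1

/-- The polynomial equation has exactly one root in `(0, 1)`. -/
theorem scenarioEquation_existsUnique {s N : ℕ} (hs : s < N) {β : ℝ} (h0 : 0 < β) (h1 : β < 1) :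
    ∃! t : ℝ, 0 < t ∧ t < 1 ∧ ScenarioEquation s β N t := by
  have hN : (0 : ℝ) < N := by exact_mod_cast (by omega : 0 < N)
  have hβN : 0 < β / N := div_pos h0 hN
  have hC : (0 : ℝ) < N.choose s := by exact_mod_cast Nat.choose_pos hs.le
  set F : ℝ → ℝ := fun t => (N.choose s : ℝ) * t ^ (N - s) -
    β / N * ∑ m ∈ Finset.Ico s N, (m.choose s : ℝ) * t ^ (m - s) with hF
  have hcont : Continuous F := by simp only [hF]; fun_prop
  have hF0 : F 0 < 0 := by
    have hsum : ∑ m ∈ Finset.Ico s N, (m.choose s : ℝ) * (0 : ℝ) ^ (m - s) = 1 := by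
      rw [Finset.sum_eq_single s]
      · simp
      · intro m hm hne
        have := (Finset.mem_Ico.1 hm).1
        rw [zero_pow (by omega), mul_zero]
      · intro h
        exact absurd (Finset.mem_Ico.2 ⟨le_rfl, hs⟩) h
    simp only [hF, hsum, zero_pow (show N - s ≠ 0 by omega)]
    linarith
  have hF1 : 0 < F 1 := by
    have hsum : ∑ m ∈ Finset.Ico s N, (m.choose s : ℝ) * (1 : ℝ) ^ (m - s) ≤
        N * (N.choose s : ℝ) := by
      calc ∑ m ∈ Finset.Ico s N, (m.choose s : ℝ) * (1 : ℝ) ^ (m - s)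
          ≤ ∑ m ∈ Finset.Ico s N, (N.choose s : ℝ) := by
            refine Finset.sum_le_sum fun m hm => ?_
            rw [one_pow, mul_one]
            exact_mod_cast Nat.choose_le_choose s (Finset.mem_Ico.1 hm).2.le
        _ = ((N - s : ℕ) : ℝ) * (N.choose s : ℝ) := by simp
        _ ≤ N * (N.choose s : ℝ) := by
            gcongr
            omega
    have h2 : β / N * ∑ m ∈ Finset.Ico s N, (m.choose s : ℝ) * (1 : ℝ) ^ (m - s) ≤
        β * N.choose s := by
      calc _ ≤ β / N * (N * (N.choose s : ℝ)) := by gcongr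
        _ = β * N.choose s := by field_simp
    simp only [hF, one_pow, mul_one] at h2 ⊢
    nlinarith
  obtain ⟨t, ht, hFt⟩ : ∃ t ∈ Set.Icc (0 : ℝ) 1, F t = 0 :=
    intermediate_value_Icc zero_le_one hcont.continuousOn ⟨hF0.le, hF1.le⟩
  have key : ∀ a b : ℝ, 0 < a → a < b → F a = 0 → F b = 0 → False := by
    intro a b ha hab hFa hFb
    have hb : 0 < b := ha.trans hab
    have e1 : F a * b ^ (N - s) - F b * a ^ (N - s) = β / N * ∑ m ∈ Finset.Ico s N,
        (m.choose s : ℝ) * (b ^ (m - s) * a ^ (N - s) - a ^ (m - s) * b ^ (N - s)) := by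
      simp only [hF, mul_sub, Finset.sum_sub_distrib, sub_mul, Finset.mul_sum, Finset.sum_mul]
      ring_nf
    rw [hFa, hFb, zero_mul, zero_mul, sub_zero] at e1
    have : ∑ m ∈ Finset.Ico s N,
        (m.choose s : ℝ) * (b ^ (m - s) * a ^ (N - s) - a ^ (m - s) * b ^ (N - s)) < 0 := by
      refine Finset.sum_neg (fun m hm => ?_) ⟨s, Finset.mem_Ico.2 ⟨le_rfl, hs⟩⟩
      obtain ⟨hm1, hm2⟩ := Finset.mem_Ico.1 hm
      have hc : (0 : ℝ) < m.choose s := by exact_mod_cast Nat.choose_pos hm1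
      refine mul_neg_of_pos_of_neg hc ?_
      have e3 : N - s = (m - s) + (N - m) := by omega
      have e4 : a ^ (N - m) < b ^ (N - m) := pow_lt_pow_left₀ hab ha.le (by omega)
      rw [e3, pow_add, pow_add]
      have : 0 < a ^ (m - s) * b ^ (m - s) := by positivity
      nlinarith
    nlinarith
  have ht0 : 0 < t := lt_of_le_of_ne ht.1 (by rintro rfl; exact absurd hFt hF0.ne)
  have ht1 : t < 1 := lt_of_le_of_ne ht.2 (by rintro rfl; exact absurd hFt hF1.ne')
  refine ⟨t, ⟨ht0, ht1, hFt⟩, ?_⟩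
  rintro u ⟨hu0, -, hFu⟩
  rcases lt_trichotomy u t with h | h | h
  · exact (key u t hu0 h hFu hFt).elim
  · exact h
  · exact (key t u ht0 h hFt hFu).elim

/-! The argument has a statistical half and a dynamical half, both phrased through the set A(x) of
ℓ-sequences exhibited by the length-H trajectory from x.

Statistics: the program is solved by the indicator of the union θ of the A(x_i), and its complexity
is the size k of a smallest nonempty subfamily I with that union. If the whole sample compresses to
I, so does every subsample U containing I, and the N - |U| remaining independent points all satisfy
A ≤ θ. Hence, with q = P(A ≤ θ), the probability of (I, θ) is at most q^(N-|U|) times its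
probability on U (`measureReal_compressionEvent_le`). Averaging over the U of each size m and
weighting by the scenario inequality, valid for q below the root, removes q altogether
(`measureReal_compressionEvent_le_sum`). For fixed U the events are disjoint, so each of the N sizes
contributes mass at most 1, and the factor β/N leaves β (`measureReal_lt_one_sub_scenarioBound_le`).

Dynamics: it remains to see that A(x) ⊆ θ forces every window of the infinite output from x into θ.
Determinism makes each window a function of its predecessor (`eq_window_succ`). Then either
pigeonhole puts all windows into the first |Y|^(ℓ-1) ones (`exists_lt_window_eq`), or, when the
data-driven abstraction is non-blocking, its transitions must follow the true windows
(`window_mem_of_nonBlocking`). -/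

/-! ### The scenario bound -/

/-- Below the root of the scenario equation its left-hand side is nonpositive. -/
theorem choose_mul_pow_le_of_lt_scenarioBound {s N : ℕ} (hs : s < N) {β : ℝ} (h0 : 0 < β)
    (h1 : β < 1) {q : ℝ} (hq0 : 0 ≤ q) (hq : q < 1 - scenarioBound s β N) :
    (N.choose s : ℝ) * q ^ (N - s) ≤
      β / N * ∑ m ∈ Finset.Ico s N, (m.choose s : ℝ) * q ^ (m - s) := by
  obtain ⟨t, ⟨ht0, ht1, ht⟩, huniq⟩ := scenarioEquation_existsUnique hs h0 h1
  have hset : {t : ℝ | 0 < t ∧ t < 1 ∧ ScenarioEquation s β N t} = {t} :=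
    Set.eq_singleton_iff_unique_mem.2 ⟨⟨ht0, ht1, ht⟩, huniq⟩
  rw [scenarioBound, if_pos hs, hset, csSup_singleton, sub_sub_cancel] at hq
  -- The difference of the two sides is negative at 0; were it positive at q, it would have a root
  -- in (0, q], below the unique root t.
  by_contra! hcon
  set F : ℝ → ℝ := fun t => (N.choose s : ℝ) * t ^ (N - s) -
    β / N * ∑ m ∈ Finset.Ico s N, (m.choose s : ℝ) * t ^ (m - s) with hF
  have hcont : Continuous F := by simp only [hF]; fun_prop
  have hF0 : F 0 < 0 := by
    have hsum : ∑ m ∈ Finset.Ico s N, (m.choose s : ℝ) * (0 : ℝ) ^ (m - s) = 1 := by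
      rw [Finset.sum_eq_single_of_mem s (Finset.mem_Ico.2 ⟨le_rfl, hs⟩)]
      · simp
      · intro m hm hne
        have := (Finset.mem_Ico.1 hm).1
        rw [zero_pow (by omega), mul_zero]
    have : 0 < β / N := div_pos h0 (by exact_mod_cast (by omega : 0 < N))
    simp only [hF, hsum, zero_pow (show N - s ≠ 0 by omega)]
    linarith
  have hFq : 0 < F q := sub_pos.2 hcon
  obtain ⟨u, hu, hFu⟩ : ∃ u ∈ Set.Icc 0 q, F u = 0 :=
    intermediate_value_Icc hq0 hcont.continuousOn ⟨hF0.le, hFq.le⟩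
  have hu0 : 0 < u := lt_of_le_of_ne hu.1 (by rintro rfl; exact hF0.ne hFu)
  have := huniq u ⟨hu0, by linarith [hu.2], hFu⟩
  linarith [hu.2]

/-! ### Smallest subcovers -/

section Cover

variable {α : Type*} [SemilatticeSup α] [OrderBot α] {N : ℕ}

/-- The nonempty subfamily `I` of the family `U` has the same supremum. -/
def Supports (a : Fin N → α) (U I : Finset (Fin N)) : Prop :=
  I ⊆ U ∧ I.Nonempty ∧ I.sup a = U.sup a

/-- The least cardinality of a nonempty subfamily with the same supremum as the whole family. -/
noncomputable def coverNumber (a : Fin N → α) : ℕ :=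
  sInf {m | ∃ I : Finset (Fin N), I.card = m ∧ Supports a Finset.univ I}

/-- A total preference order on index sets: by cardinality, with ties broken arbitrarily. -/
noncomputable def coverKey (I : Finset (Fin N)) : ℕ ×ₗ Fin (Fintype.card (Finset (Fin N))) :=
  toLex (I.card, Fintype.equivFin _ I)

theorem coverKey_injective : Function.Injective (coverKey (N := N)) := fun I J h => by
  have := congrArg (fun p => (ofLex p).2) h
  simpa [coverKey] using this

theorem card_le_of_coverKey_le {I J : Finset (Fin N)} (h : coverKey I ≤ coverKey J) :
    I.card ≤ J.card := by
  rw [coverKey, coverKey, Prod.Lex.toLex_le_toLex] at h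
  rcases h with h | h
  · exact h.le
  · exact h.1.le

/-- `I` is the preferred subfamily of `U` with the same supremum. -/
def IsCompression (a : Fin N → α) (U I : Finset (Fin N)) : Prop :=
  Supports a U I ∧ ∀ J, Supports a U J → coverKey I ≤ coverKey J

theorem IsCompression.unique {a : Fin N → α} {U I J : Finset (Fin N)} (hI : IsCompression a U I)
    (hJ : IsCompression a U J) : I = J :=
  coverKey_injective (le_antisymm (hI.2 J hJ.1) (hJ.2 I hI.1))

theorem IsCompression.card_eq {a : Fin N → α} {I : Finset (Fin N)}
    (hI : IsCompression a Finset.univ I) : I.card = coverNumber a := by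
  refine le_antisymm (le_csInf ⟨_, I, rfl, hI.1⟩ ?_) (Nat.sInf_le ⟨I, rfl, hI.1⟩)
  rintro m ⟨J, rfl, hJ⟩
  exact card_le_of_coverKey_le (hI.2 J hJ)

theorem exists_isCompression (a : Fin N → α) {U : Finset (Fin N)} (hU : U.Nonempty) :
    ∃ I, IsCompression a U I := by
  classical
  obtain ⟨I, hI, hmin⟩ := Finset.exists_min_image (U.powerset.filter (Supports a U)) coverKey
    ⟨U, by simp [Supports, hU]⟩
  refine ⟨I, (Finset.mem_filter.1 hI).2, fun J hJ => hmin J ?_⟩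
  simp [hJ, hJ.1]

/-- Preference: the compression of a family is the compression of all subfamilies containing it. -/
theorem IsCompression.mono {a : Fin N → α} {U V I : Finset (Fin N)} (hI : IsCompression a V I)
    (hIU : I ⊆ U) (hUV : U ⊆ V) : IsCompression a U I ∧ U.sup a = V.sup a := by
  -- The supremum over U lies between those over I and V, which agree; so every competitor on U is
  -- also one on V.
  have hsup : U.sup a = V.sup a :=
    le_antisymm (Finset.sup_mono hUV) (hI.1.2.2 ▸ Finset.sup_mono hIU)
  refine ⟨⟨⟨hIU, hI.1.2.1, hI.1.2.2.trans hsup.symm⟩, fun J hJ => hI.2 J ?_⟩, hsup⟩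
  exact ⟨hJ.1.trans hUV, hJ.2.1, hJ.2.2.trans hsup⟩

theorem Supports.congr {a b : Fin N → α} {U I : Finset (Fin N)} (h : ∀ i ∈ U, a i = b i)
    (hI : Supports a U I) : Supports b U I :=
  ⟨hI.1, hI.2.1, by
    rw [← Finset.sup_congr rfl h, ← Finset.sup_congr rfl fun i hi => h i (hI.1 hi), hI.2.2]⟩

theorem IsCompression.congr {a b : Fin N → α} {U I : Finset (Fin N)} (h : ∀ i ∈ U, a i = b i)
    (hI : IsCompression a U I) : IsCompression b U I :=
  ⟨hI.1.congr h, fun J hJ => hI.2 J (hJ.congr fun i hi => (h i hi).symm)⟩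

theorem isCompression_congr {a b : Fin N → α} {U I : Finset (Fin N)} (h : ∀ i ∈ U, a i = b i) :
    IsCompression a U I ↔ IsCompression b U I :=
  ⟨fun hI => hI.congr h, fun hI => hI.congr fun i hi => (h i hi).symm⟩

end Cover

/-! ### The probability of a large violation -/

section Probability

open ProbabilityTheory

theorem measurableSet_preimage_comp {Ω α : Type*} [MeasurableSpace Ω] [Finite α] {N : ℕ}
    {A : Ω → α} (hA : ∀ a, MeasurableSet (A ⁻¹' {a})) {κ : Type*} [Finite κ] {e : κ → Fin N}
    (S : Set (κ → α)) : MeasurableSet ((fun (x : Fin N → Ω) i => A (x (e i))) ⁻¹' S) := by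
  let _ : MeasurableSpace α := ⊤
  have hA' : Measurable A := measurable_to_countable' hA
  have : Measurable fun (x : Fin N → Ω) i => A (x (e i)) := by fun_prop
  exact this S.toFinite.measurableSet

variable {Ω α : Type*} [SemilatticeSup α] [OrderBot α] {N : ℕ}

/-- The event that the sample compresses to `I` on `U`, with supremum `θ`. -/
def compressionEvent (A : Ω → α) (U I : Finset (Fin N)) (θ : α) : Set (Fin N → Ω) :=
  {x | IsCompression (fun i => A (x i)) U I ∧ U.sup (fun i => A (x i)) = θ}

/-- Compressing U only involves the coordinates in U, so the others can be filled with `⊥`. This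
gives both measurability and independence from the coordinates outside U. -/
theorem compressionEvent_eq_preimage (A : Ω → α) (U I : Finset (Fin N)) (θ : α) :
    ∃ S : Set (U → α), compressionEvent A U I θ = (fun x (i : U) => A (x i)) ⁻¹' S := by
  classical
  refine ⟨{b | IsCompression (fun i => if h : i ∈ U then b ⟨i, h⟩ else ⊥) U I ∧
    U.sup (fun i => if h : i ∈ U then b ⟨i, h⟩ else ⊥) = θ}, ?_⟩
  ext x
  have h : ∀ i ∈ U, A (x i) = if _ : i ∈ U then A (x i) else ⊥ := fun i hi => by simp [hi]
  simp only [compressionEvent, Set.mem_ofPred_eq, Set.mem_preimage]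
  rw [isCompression_congr h, Finset.sup_congr rfl h]

variable [MeasurableSpace Ω] [Finite α] {A : Ω → α}

theorem measurableSet_compressionEvent (hA : ∀ a, MeasurableSet (A ⁻¹' {a}))
    (U I : Finset (Fin N)) (θ : α) : MeasurableSet (compressionEvent A U I θ) := by
  obtain ⟨S, hS⟩ := compressionEvent_eq_preimage A U I θ
  rw [hS]
  exact measurableSet_preimage_comp hA S

variable (P : Measure Ω) [IsProbabilityMeasure P]

/-- By `IsCompression.mono`, compression of the full sample to I passes to U with the same supremum
θ, while the points outside U must lie below θ. The two conditions concern disjoint sets of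
independent coordinates. -/
theorem measureReal_compressionEvent_le (hA : ∀ a, MeasurableSet (A ⁻¹' {a}))
    {U I : Finset (Fin N)} (hIU : I ⊆ U) (θ : α) :
    (Measure.pi fun _ => P).real (compressionEvent A Finset.univ I θ) ≤
      (Measure.pi fun _ => P).real (compressionEvent A U I θ) *
        P.real {ω | A ω ≤ θ} ^ (N - U.card) := by
  let _ : MeasurableSpace α := ⊤
  have hA' : Measurable A := measurable_to_countable' hA
  set μ : Measure (Fin N → Ω) := Measure.pi fun _ => P
  obtain ⟨S, hS⟩ := compressionEvent_eq_preimage A U I θ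
  set T : Set ((Uᶜ : Finset (Fin N)) → α) := {b | ∀ i, b i ≤ θ}
  have hind : IndepFun (fun (x : Fin N → Ω) (i : U) => A (x i))
      (fun (x : Fin N → Ω) (i : (Uᶜ : Finset (Fin N))) => A (x i)) μ :=
    (iIndepFun_pi (μ := fun _ : Fin N => P) (X := fun _ => A)
      fun _ => hA'.aemeasurable).indepFun_finset U Uᶜ disjoint_compl_right fun i => by fun_prop
  have hsub : compressionEvent A Finset.univ I θ ⊆
      (fun (x : Fin N → Ω) (i : U) => A (x i)) ⁻¹' S ∩
        (fun (x : Fin N → Ω) (i : (Uᶜ : Finset (Fin N))) => A (x i)) ⁻¹' T := by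
    rintro x ⟨hx, rfl⟩
    obtain ⟨h1, h2⟩ := hx.mono hIU U.subset_univ
    refine ⟨?_, fun i => Finset.le_sup (f := fun i => A (x i)) (Finset.mem_univ i.1)⟩
    rw [← hS]
    exact ⟨h1, h2⟩
  have hT : μ.real ((fun (x : Fin N → Ω) (i : (Uᶜ : Finset (Fin N))) => A (x i)) ⁻¹' T) =
      P.real {ω | A ω ≤ θ} ^ (N - U.card) := by
    classical
    have : (fun (x : Fin N → Ω) (i : (Uᶜ : Finset (Fin N))) => A (x i)) ⁻¹' T =
        Set.univ.pi fun i => if i ∈ U then Set.univ else {ω | A ω ≤ θ} := by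
      ext x
      simp only [T, Set.mem_preimage, Set.mem_ofPred_eq, Subtype.forall, Finset.mem_compl,
        Set.mem_univ_pi]
      refine forall_congr' fun i => ?_
      by_cases hi : i ∈ U <;> simp [hi]
    rw [this, Measure.real, Measure.pi_pi, ENNReal.toReal_prod,
      ← Finset.prod_mul_prod_compl U, Finset.prod_eq_one fun i hi => by simp [hi], one_mul,
      Finset.prod_congr rfl fun i hi => by rw [if_neg (Finset.mem_compl.1 hi)],
      Finset.prod_const, Finset.card_compl, Fintype.card_fin, Measure.real]
  calc μ.real (compressionEvent A Finset.univ I θ) ≤ _ := measureReal_mono hsub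
    _ = _ := by
      rw [Measure.real, hind.measure_inter_preimage_eq_mul S T S.toFinite.measurableSet
        T.toFinite.measurableSet, ENNReal.toReal_mul]
      change μ.real _ * μ.real _ = _
      rw [hT, hS]

/-- A sample determines its compression on U and its supremum, so the events are pairwise disjoint.
-/
theorem sum_measureReal_compressionEvent_le [Fintype α] (hA : ∀ a, MeasurableSet (A ⁻¹' {a}))
    (U : Finset (Fin N)) :
    ∑ p : Finset (Fin N) × α, (Measure.pi fun _ => P).real (compressionEvent A U p.1 p.2) ≤ 1 := by
  rw [← measureReal_biUnion_finset]
  · exact measureReal_le_one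
  · intro p _ q _ hpq
    refine Set.disjoint_left.2 fun x hp hq => hpq ?_
    exact Prod.ext (hp.1.unique hq.1) (hp.2.symm.trans hq.2)
  · exact fun p _ => measurableSet_compressionEvent hA U p.1 p.2

/-- The probability of compressing to `I`, with a supremum exceeded with large probability, is
dominated by averages, over all sizes of subsamples, of the probabilities that the subsamples
compress to `I`. -/
theorem measureReal_compressionEvent_le_sum (hA : ∀ a, MeasurableSet (A ⁻¹' {a})) {β : ℝ}
    (h0 : 0 < β) (h1 : β < 1) {I : Finset (Fin N)} {θ : α} (hI : I.card < N)
    (hq : P.real {ω | A ω ≤ θ} < 1 - scenarioBound I.card β N) :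
    (Measure.pi fun _ => P).real (compressionEvent A Finset.univ I θ) ≤
      β / N * ∑ m ∈ Finset.range N, (N.choose m : ℝ)⁻¹ *
        ∑ U ∈ Finset.powersetCard m Finset.univ,
          (Measure.pi fun _ => P).real (compressionEvent A U I θ) := by
  classical
  set μ : Measure (Fin N → Ω) := Measure.pi fun _ => P
  set q := P.real {ω | A ω ≤ θ} with hqdef
  set a := μ.real (compressionEvent A Finset.univ I θ)
  set k := I.card
  have hN : (0 : ℝ) < N := by exact_mod_cast (by omega : 0 < N)
  have hq0 : 0 ≤ q := measureReal_nonneg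
  -- The end of the proof cancels a power of q. For q = 0 the bound with U = I already gives
  -- probability 0, since N - k > 0.
  rcases hq0.eq_or_lt with hq' | hqpos
  · have := measureReal_compressionEvent_le P hA (subset_refl I) θ
    rw [← hqdef, ← hq', zero_pow (by omega), mul_zero] at this
    exact this.trans (by positivity)
  have ha : 0 ≤ a := measureReal_nonneg
  have hC : (0 : ℝ) < N.choose k := by exact_mod_cast Nat.choose_pos hI.le
  have hkey := choose_mul_pow_le_of_lt_scenarioBound hI h0 h1 hq0 hq
  -- Sum the bound over the C(N-k, m-k) sets U ⊇ I of size m, then use C(N,m) C(m,k) = C(N,k)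
  -- C(N-k,m-k).
  have hterm : ∀ m ∈ Finset.Ico k N, (m.choose k : ℝ) * q ^ (m - k) * a ≤
      N.choose k * q ^ (N - k) * ((N.choose m : ℝ)⁻¹ *
        ∑ U ∈ Finset.powersetCard m Finset.univ, μ.real (compressionEvent A U I θ)) := by
    intro m hm
    obtain ⟨hkm, hmN⟩ := Finset.mem_Ico.1 hm
    have hCm : (0 : ℝ) < N.choose m := by exact_mod_cast Nat.choose_pos hmN.le
    have hcard : ((Finset.powersetCard m (Finset.univ : Finset (Fin N))).filter (I ⊆ ·)).card =
        (N - k).choose (m - k) := by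
      rw [Finset.card_filter_powersetCard_subset _ _ _ I.subset_univ hkm, Finset.card_univ,
        Fintype.card_fin]
    have hsum : ((N - k).choose (m - k) : ℝ) * a ≤ q ^ (N - m) *
        ∑ U ∈ Finset.powersetCard m Finset.univ, μ.real (compressionEvent A U I θ) := by
      calc ((N - k).choose (m - k) : ℝ) * a
          = ∑ U ∈ (Finset.powersetCard m Finset.univ).filter (I ⊆ ·), a := by
            rw [Finset.sum_const, hcard, nsmul_eq_mul]
        _ ≤ ∑ U ∈ (Finset.powersetCard m Finset.univ).filter (I ⊆ ·),
              q ^ (N - m) * μ.real (compressionEvent A U I θ) := by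
            refine Finset.sum_le_sum fun U hU => ?_
            obtain ⟨hU1, hU2⟩ := Finset.mem_filter.1 hU
            have := measureReal_compressionEvent_le P hA hU2 θ
            rwa [(Finset.mem_powersetCard.1 hU1).2, mul_comm] at this
        _ ≤ ∑ U ∈ Finset.powersetCard m Finset.univ,
              q ^ (N - m) * μ.real (compressionEvent A U I θ) :=
            Finset.sum_le_sum_of_subset_of_nonneg (Finset.filter_subset _ _)
              fun _ _ _ => by positivity
        _ = _ := by rw [Finset.mul_sum]
    have hchoose : (N.choose m : ℝ) * m.choose k = N.choose k * (N - k).choose (m - k) := by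
      exact_mod_cast Nat.choose_mul hkm
    rw [show N - k = (m - k) + (N - m) by omega, pow_add]
    rw [← mul_le_mul_iff_right₀ hCm]
    calc (N.choose m : ℝ) * (m.choose k * q ^ (m - k) * a)
        = N.choose k * q ^ (m - k) * ((N - k).choose (m - k) * a) := by
          linear_combination q ^ (m - k) * a * hchoose
      _ ≤ N.choose k * q ^ (m - k) * (q ^ (N - m) *
            ∑ U ∈ Finset.powersetCard m Finset.univ, μ.real (compressionEvent A U I θ)) := by
          gcongr
      _ = _ := by field_simp
  have hpos : 0 < (N.choose k : ℝ) * q ^ (N - k) := by positivity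
  rw [← mul_le_mul_iff_right₀ hpos]
  calc (N.choose k : ℝ) * q ^ (N - k) * a
      ≤ (β / N * ∑ m ∈ Finset.Ico k N, (m.choose k : ℝ) * q ^ (m - k)) * a := by gcongr
    _ = β / N * ∑ m ∈ Finset.Ico k N, (m.choose k : ℝ) * q ^ (m - k) * a := by
        rw [mul_assoc, Finset.sum_mul]
    _ ≤ β / N * ∑ m ∈ Finset.Ico k N, N.choose k * q ^ (N - k) * ((N.choose m : ℝ)⁻¹ *
          ∑ U ∈ Finset.powersetCard m Finset.univ, μ.real (compressionEvent A U I θ)) := by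
        exact mul_le_mul_of_nonneg_left (Finset.sum_le_sum hterm) (by positivity)
    _ ≤ β / N * ∑ m ∈ Finset.range N, N.choose k * q ^ (N - k) * ((N.choose m : ℝ)⁻¹ *
          ∑ U ∈ Finset.powersetCard m Finset.univ, μ.real (compressionEvent A U I θ)) := by
        refine mul_le_mul_of_nonneg_left (Finset.sum_le_sum_of_subset_of_nonneg
          (fun m hm => Finset.mem_range.2 (Finset.mem_Ico.1 hm).2) fun _ _ _ => ?_) (by positivity)
        positivity
    _ = _ := by rw [← Finset.mul_sum]; ring

/-- Averages over the subsets of a given size of quantities of total mass at most one. -/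
theorem sum_sum_inv_choose_mul_le {N : ℕ} {κ : Type*} [Fintype κ] {g : Finset (Fin N) → κ → ℝ}
    (hg : ∀ U, ∑ p, g U p ≤ 1) :
    ∑ p, ∑ m ∈ Finset.range N, (N.choose m : ℝ)⁻¹ *
      ∑ U ∈ Finset.powersetCard m Finset.univ, g U p ≤ N := by
  rw [Finset.sum_comm]
  calc ∑ m ∈ Finset.range N, ∑ p, (N.choose m : ℝ)⁻¹ *
        ∑ U ∈ Finset.powersetCard m Finset.univ, g U p
      ≤ ∑ m ∈ Finset.range N, (1 : ℝ) := by
        refine Finset.sum_le_sum fun m hm => ?_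
        have hC : (0 : ℝ) < N.choose m := by
          exact_mod_cast Nat.choose_pos (Finset.mem_range.1 hm).le
        rw [← Finset.mul_sum, Finset.sum_comm, inv_mul_le_iff₀ hC, mul_one]
        calc ∑ U ∈ Finset.powersetCard m Finset.univ, ∑ p, g U p
            ≤ ∑ U ∈ Finset.powersetCard m (Finset.univ : Finset (Fin N)), (1 : ℝ) :=
              Finset.sum_le_sum fun U _ => hg U
          _ = N.choose m := by simp
    _ = N := by simp

/-- The averages that dominate the bad pairs (I, θ) have total mass at most N over all pairs, which
cancels the denominator of β/N. -/
theorem sum_measureReal_compressionEvent_univ_le [Fintype α] (hA : ∀ a, MeasurableSet (A ⁻¹' {a}))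
    {β : ℝ} (h0 : 0 < β) (h1 : β < 1) (hN : 0 < N) (B : Finset (Finset (Fin N) × α))
    (hB : ∀ p ∈ B, p.1.card < N ∧ P.real {ω | A ω ≤ p.2} < 1 - scenarioBound p.1.card β N) :
    ∑ p ∈ B, (Measure.pi fun _ => P).real (compressionEvent A Finset.univ p.1 p.2) ≤ β := by
  classical
  set μ : Measure (Fin N → Ω) := Measure.pi fun _ => P
  have hN' : (0 : ℝ) < N := by exact_mod_cast hN
  have hU : ∀ U : Finset (Fin N),
      ∑ p : Finset (Fin N) × α, μ.real (compressionEvent A U p.1 p.2) ≤ 1 :=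
    sum_measureReal_compressionEvent_le P hA
  have hmass : ∑ p : Finset (Fin N) × α, ∑ m ∈ Finset.range N, (N.choose m : ℝ)⁻¹ *
      ∑ U ∈ Finset.powersetCard m Finset.univ, μ.real (compressionEvent A U p.1 p.2) ≤ N :=
    sum_sum_inv_choose_mul_le hU
  calc ∑ p ∈ B, μ.real (compressionEvent A Finset.univ p.1 p.2)
      ≤ ∑ p ∈ B, β / N * ∑ m ∈ Finset.range N, (N.choose m : ℝ)⁻¹ *
          ∑ U ∈ Finset.powersetCard m Finset.univ, μ.real (compressionEvent A U p.1 p.2) := by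
        refine Finset.sum_le_sum fun p hp => ?_
        obtain ⟨hp1, hp2⟩ := hB p hp
        exact measureReal_compressionEvent_le_sum P hA h0 h1 hp1 hp2
    _ ≤ ∑ p : Finset (Fin N) × α, β / N * ∑ m ∈ Finset.range N, (N.choose m : ℝ)⁻¹ *
          ∑ U ∈ Finset.powersetCard m Finset.univ, μ.real (compressionEvent A U p.1 p.2) :=
        Finset.sum_le_sum_of_subset_of_nonneg B.subset_univ fun _ _ _ => by positivity
    _ ≤ β / N * N := by
        rw [← Finset.mul_sum]
        exact mul_le_mul_of_nonneg_left hmass (div_nonneg h0.le hN'.le)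
    _ = β := div_mul_cancel₀ _ hN'.ne'

/-- The wait-and-judge bound for suprema: except with probability `β`, a new sample is dominated
by the supremum of the given ones with probability at least `1 - ε`, where `ε` is the scenario
bound at the covering number. -/
theorem measureReal_lt_one_sub_scenarioBound_le (hA : ∀ a, MeasurableSet (A ⁻¹' {a})) {β : ℝ}
    (h0 : 0 < β) (h1 : β < 1) :
    (Measure.pi fun _ : Fin N => P).real
      {x | P.real {ω | A ω ≤ Finset.univ.sup fun i => A (x i)} <
        1 - scenarioBound (coverNumber fun i => A (x i)) β N} ≤ β := by
  classical
  have := Fintype.ofFinite α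
  set μ : Measure (Fin N → Ω) := Measure.pi fun _ => P
  set B : Finset (Finset (Fin N) × α) := Finset.univ.filter fun p =>
    p.1.card < N ∧ P.real {ω | A ω ≤ p.2} < 1 - scenarioBound p.1.card β N
  have hsub : {x : Fin N → Ω | P.real {ω | A ω ≤ Finset.univ.sup fun i => A (x i)} <
      1 - scenarioBound (coverNumber fun i => A (x i)) β N} ⊆
      ⋃ p ∈ B, compressionEvent A Finset.univ p.1 p.2 := by
    intro x hx
    have hx : P.real {ω | A ω ≤ Finset.univ.sup fun i => A (x i)} <
      1 - scenarioBound (coverNumber fun i => A (x i)) β N := hx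
    -- At covering number N the scenario bound is 1, and no probability is below 0.
    have hlt : (coverNumber fun i => A (x i)) < N := by
      by_contra hN
      rw [scenarioBound, if_neg hN, sub_self] at hx
      exact hx.not_ge measureReal_nonneg
    obtain ⟨I, hI⟩ := exists_isCompression (fun i => A (x i))
      (U := (Finset.univ : Finset (Fin N))) ⟨⟨0, by omega⟩, Finset.mem_univ _⟩
    refine Set.mem_biUnion (x := (I, Finset.univ.sup fun i => A (x i))) ?_ ⟨hI, rfl⟩
    rw [← hI.card_eq] at hx hlt
    exact Finset.mem_filter.2 ⟨Finset.mem_univ _, hlt, hx⟩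
  rcases N.eq_zero_or_pos with hN | hN
  · have hB : B = ∅ := Finset.filter_false_of_mem fun p _ => by omega
    rw [hB] at hsub
    rw [Set.subset_empty_iff.1 (hsub.trans (by simp)), measureReal_empty]
    exact h0.le
  exact (measureReal_mono hsub (measure_ne_top _ _)).trans <| (measureReal_biUnion_finset_le _ _).trans
    (sum_measureReal_compressionEvent_univ_le P hA h0 h1 hN B fun p hp => (Finset.mem_filter.1 hp).2)

end Probability

/-! ### Behaviours of the embedding -/

namespace OutputSystem

variable {n : ℕ} {Y : Type*} (S : OutputSystem n Y)

/-- The infinite output trajectory started at `x`. -/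
def output (x : S.D) : ℕ → Y := fun k => S.h (S.f^[k] x)

/-- The `ℓ`-window of the output trajectory at time `k`. -/
def window (ℓ : ℕ) (x : S.D) (k : ℕ) : Fin ℓ → Y := fun j => S.output x (k + j)

variable {S}

theorem iterate_mem (hS : S.embedding.NonBlocking) (x : S.D) (k : ℕ) :
    S.f^[k] (x : EuclideanSpace ℝ (Fin n)) ∈ S.D := by
  induction k with
  | zero => exact x.2
  | succ k ih =>
    obtain ⟨x', hx'⟩ := hS ⟨_, ih⟩
    rw [Function.iterate_succ_apply']
    have : (x' : EuclideanSpace ℝ (Fin n)) = S.f (S.f^[k] x) := hx'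
    exact this ▸ x'.2

theorem behavioursFrom_embedding (hS : S.embedding.NonBlocking) (x : S.D) :
    S.embedding.behavioursFrom x = {S.output x} := by
  ext y
  constructor
  · rintro ⟨r, h0, hr, hy⟩
    have h : ∀ k, (r k : EuclideanSpace ℝ (Fin n)) = S.f^[k] x := by
      intro k
      induction k with
      | zero => rw [h0]; rfl
      | succ k ih =>
        rw [Function.iterate_succ_apply', ← ih]
        exact hr k
    funext k
    rw [← hy k]
    exact congrArg S.h (h k)
  · rintro rfl
    refine ⟨fun k => ⟨_, iterate_mem hS x k⟩, rfl, fun k => ?_, fun k => rfl⟩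
    exact Function.iterate_succ_apply' _ _ _

theorem window_mem_subsequences (hS : S.embedding.NonBlocking) (ℓ : ℕ) (x : S.D) (k : ℕ) :
    S.window ℓ x k ∈ S.embedding.subsequences ℓ := by
  refine ⟨S.output x, ⟨x, Set.mem_univ _, ?_⟩, k, fun i => rfl⟩
  rw [behavioursFrom_embedding hS]
  rfl

theorem exhibits_trajectory_iff {ℓ H : ℕ} {x : S.D} {w : Fin ℓ → Y} :
    Exhibits (S.trajectory H x) w ↔ ∃ k, k + ℓ ≤ H ∧ S.window ℓ x k = w := by
  constructor
  · rintro ⟨k, hk, h⟩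
    exact ⟨k, hk, funext h⟩
  · rintro ⟨k, hk, rfl⟩
    exact ⟨k, hk, fun i => rfl⟩

theorem mem_subsequences_of_mem_witnessed (hS : S.embedding.NonBlocking) {ℓ H N : ℕ}
    {x : Fin N → S.D} {w : Fin ℓ → Y} (hw : w ∈ S.witnessed ℓ H x) :
    w ∈ S.embedding.subsequences ℓ := by
  obtain ⟨i, hi⟩ := hw
  obtain ⟨k, -, rfl⟩ := exhibits_trajectory_iff.1 hi
  exact window_mem_subsequences hS ℓ _ k

/-- Determinism of the strongest `ℓ`-complete abstraction: in it, a sequence that follows the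
window at time `k` is the window at time `k + 1`. -/
theorem eq_window_succ (hS : S.embedding.NonBlocking) {ℓ : ℕ} [NeZero ℓ]
    (hdet : (S.embedding.strongestComplete ℓ).Deterministic) (x : S.D) (k : ℕ) {w : Fin ℓ → Y}
    (hw : w ∈ S.embedding.subsequences ℓ)
    (h : ∀ i j : Fin ℓ, (j : ℕ) = i + 1 → S.window ℓ x k j = w i) :
    w = S.window ℓ x (k + 1) := by
  refine congrArg Subtype.val (hdet ⟨_, window_mem_subsequences hS ℓ x k⟩ ⟨w, hw⟩
    ⟨_, window_mem_subsequences hS ℓ x (k + 1)⟩ h fun i j hij => ?_)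
  simp only [window, hij]
  congr 1
  omega

/-- If all windows of the trajectory are states of a domino system all of whose states are
initial, then the output trajectory is a behaviour of that system. -/
theorem output_mem_behaviours_domino {ℓ : ℕ} [NeZero ℓ] {W : Set (Fin ℓ → Y)} (x : S.D)
    (h : ∀ k, S.window ℓ x k ∈ W) :
    S.output x ∈ (TransitionSystem.domino W Set.univ).behaviours := by
  refine ⟨⟨_, h 0⟩, Set.mem_univ _, fun k => ⟨_, h k⟩, rfl, fun k i j hij => ?_, fun k => rfl⟩
  simp only [window, hij]
  congr 1
  omega

/-- Under determinism, two windows with the same first `ℓ - 1` letters agree. -/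
theorem window_eq_window_of_prefix (hS : S.embedding.NonBlocking) {ℓ : ℕ} [NeZero ℓ]
    (hdet : (S.embedding.strongestComplete ℓ).Deterministic) (x : S.D) {i j : ℕ}
    (h : S.window (ℓ - 1) x i = S.window (ℓ - 1) x (j + 1)) :
    S.window ℓ x i = S.window ℓ x (j + 1) := by
  refine eq_window_succ hS hdet x j (window_mem_subsequences hS ℓ x i) fun a b hab => ?_
  have := congrFun h ⟨a, by omega⟩
  simp only [window] at this ⊢
  rw [this, hab]
  congr 1
  omega

/-- Under determinism every window occurs within the first `|Y| ^ (ℓ - 1)` ones. -/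
theorem exists_lt_window_eq [Fintype Y] (hS : S.embedding.NonBlocking) {ℓ : ℕ} [NeZero ℓ]
    (hdet : (S.embedding.strongestComplete ℓ).Deterministic) (x : S.D) (k : ℕ) :
    ∃ k' < Fintype.card Y ^ (ℓ - 1), S.window ℓ x k' = S.window ℓ x k := by
  classical
  set M := Fintype.card Y ^ (ℓ - 1) with hM
  induction k using Nat.strong_induction_on with
  | _ k ih =>
    by_cases hk : k < M
    · exact ⟨k, hk, rfl⟩
    -- Pigeonhole: there are only M words of length ℓ - 1 for the M + 1 times 0, …, M.
    obtain ⟨i, j, hij, hpre⟩ : ∃ i j : Fin (M + 1), i < j ∧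
        S.window (ℓ - 1) x i = S.window (ℓ - 1) x j := by
      obtain ⟨i, j, hne, h⟩ := Fintype.exists_ne_map_eq_of_card_lt
        (fun i : Fin (M + 1) => S.window (ℓ - 1) x i) (by simp [hM])
      rcases lt_or_gt_of_ne hne with h' | h'
      · exact ⟨i, j, h', h⟩
      · exact ⟨j, i, h', h.symm⟩
    have hij' : (i : ℕ) < j := hij
    -- From time i on, the windows have period j - i.
    have hper : ∀ d, S.window ℓ x (i + d) = S.window ℓ x (j + d) := by
      intro d
      induction d with
      | zero =>
        -- Only the later window needs a predecessor, so i = 0 is allowed and M windows suffice.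
        obtain ⟨j', hj'⟩ : ∃ j', (j : ℕ) = j' + 1 := ⟨j - 1, by omega⟩
        rw [hj'] at hpre
        simpa [hj'] using window_eq_window_of_prefix hS hdet x hpre
      | succ d ihd =>
        refine eq_window_succ hS hdet x (j + d) (window_mem_subsequences hS ℓ x _) ?_
        intro a b hab
        rw [← ihd]
        simp only [window, hab]
        congr 1
        omega
    -- Since j ≤ M ≤ k, time k can be moved back by one period.
    obtain ⟨k', hk', h⟩ := ih (k - (j - i)) (by omega)
    refine ⟨k', hk', h.trans ?_⟩
    have := hper (k - j)
    rwa [show (i : ℕ) + (k - j) = k - (j - i) by omega, show (j : ℕ) + (k - j) = k by omega] at this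

/-- A trajectory of this length shows exactly the windows at times below |Y|^(ℓ-1), and these are
all the windows there are. -/
theorem window_mem_of_forall_exhibits [Fintype Y] (hS : S.embedding.NonBlocking) {ℓ : ℕ} [NeZero ℓ]
    (hdet : (S.embedding.strongestComplete ℓ).Deterministic) {H : ℕ}
    (hH : H = Fintype.card Y ^ (ℓ - 1) + ℓ - 1) {W : Set (Fin ℓ → Y)} {x : S.D}
    (hx : {w | Exhibits (S.trajectory H x) w} ⊆ W) (k : ℕ) : S.window ℓ x k ∈ W := by
  obtain ⟨k', hk', h⟩ := exists_lt_window_eq hS hdet x k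
  exact hx (exhibits_trajectory_iff.2 ⟨k', by have := NeZero.pos ℓ; omega, h⟩)

/-- A witnessed window has a witnessed successor. Witnessed sequences are states of the strongest
complete abstraction, where determinism identifies that successor with the next window. -/
theorem window_mem_of_nonBlocking (hS : S.embedding.NonBlocking) {ℓ : ℕ} [NeZero ℓ]
    (hdet : (S.embedding.strongestComplete ℓ).Deterministic) {H : ℕ} (hH : ℓ ≤ H) {N : ℕ}
    {z : Fin N → S.D} (hz : (S.dataDriven ℓ H z).NonBlocking) {x : S.D}
    (hx : {w | Exhibits (S.trajectory H x) w} ⊆ S.witnessed ℓ H z) (k : ℕ) :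
    S.window ℓ x k ∈ S.witnessed ℓ H z := by
  induction k with
  | zero => exact hx (exhibits_trajectory_iff.2 ⟨0, by omega, rfl⟩)
  | succ k ih =>
    obtain ⟨w, hw⟩ := hz ⟨_, ih⟩
    rw [← eq_window_succ hS hdet x k (mem_subsequences_of_mem_witnessed hS w.2) hw]
    exact w.2

end OutputSystem

/-! ### The scenario program -/

/-- The solution of the scenario program with 0-1 scenarios is the indicator of the union. -/
theorem isScenarioSolution_iff {ι : Type*} [Fintype ι] [Nonempty ι] {N : ℕ} {δ : Fin N → ι → ℝ}
    {A : Fin N → Set ι} (hδ : ∀ i, δ i = (A i).indicator 1) {I : Finset (Fin N)} {θ : ι → ℝ} :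
    IsScenarioSolution δ I θ ↔ I.Nonempty ∧ θ = (I.sup A).indicator 1 := by
  have hmem : ∀ j, j ∈ I.sup A ↔ ∃ i ∈ I, j ∈ A i := by simp [Finset.sup_set_eq_biUnion]
  have hfeas : ∀ i ∈ I, δ i ≤ (I.sup A).indicator 1 := fun i hi => by
    rw [hδ]
    exact Set.indicator_le_indicator_of_subset (Finset.le_sup hi) fun _ => zero_le_one
  have hle : I.Nonempty → ∀ θ' : ι → ℝ, (∀ i ∈ I, δ i ≤ θ') → (I.sup A).indicator 1 ≤ θ' := by
    rintro ⟨i₀, hi₀⟩ θ' h j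
    by_cases hj : j ∈ I.sup A
    · obtain ⟨i, hi, hji⟩ := (hmem j).1 hj
      have := h i hi j
      rw [hδ, Set.indicator_of_mem hji] at this
      rwa [Set.indicator_of_mem hj]
    -- Off the union, any single constraint still forces θ' ≥ 0.
    · refine le_trans ?_ (h i₀ hi₀ j)
      rw [hδ, Set.indicator_of_notMem hj]
      exact Set.indicator_nonneg (fun _ _ => zero_le_one) _
  constructor
  · rintro ⟨h1, h2⟩
    have hI : I.Nonempty := by
      by_contra hI
      rw [Finset.not_nonempty_iff_eq_empty] at hI
      -- Without constraints the program is unbounded below; hence the nonemptiness in `Supports`.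
      have := h2 (fun j => θ j - 1) (by simp [hI])
      simp only [Finset.sum_sub_distrib, Finset.sum_const, Finset.card_univ, nsmul_eq_mul,
        mul_one] at this
      have : (0 : ℝ) < Fintype.card ι := by exact_mod_cast Fintype.card_pos
      linarith
    refine ⟨hI, ?_⟩
    have hsum : ∑ j, (I.sup A).indicator 1 j = ∑ j, θ j :=
      le_antisymm (Finset.sum_le_sum fun j _ => hle hI θ h1 j) (h2 _ hfeas)
    funext j
    exact (((Finset.sum_eq_sum_iff_of_le fun j _ => hle hI θ h1 j).1 hsum) j
      (Finset.mem_univ j)).symm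
  · rintro ⟨hI, rfl⟩
    exact ⟨hfeas, fun θ' h => Finset.sum_le_sum fun j _ => hle hI θ' h j⟩

/-- The complexity of the scenario program with 0-1 scenarios is a covering number. -/
theorem complexity_eq_coverNumber {ι : Type*} [Fintype ι] [Nonempty ι] {N : ℕ} {δ : Fin N → ι → ℝ}
    {A : Fin N → Set ι} (hδ : ∀ i, δ i = (A i).indicator 1) : complexity δ = coverNumber A := by
  have hinj : Function.Injective fun s : Set ι => s.indicator (1 : ι → ℝ) :=
    fun s t h => Set.indicator_one_inj ℝ h
  simp only [complexity, coverNumber, Supports, isScenarioSolution_iff hδ]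
  congr 1
  ext m
  constructor
  · rintro ⟨I, hm, θ, ⟨hI, h1⟩, -, h2⟩
    exact ⟨I, hm, I.subset_univ, hI, hinj (h1.symm.trans h2)⟩
  · rintro ⟨I, hm, -, hI, h⟩
    exact ⟨I, hm, _, ⟨hI, rfl⟩, hI.mono I.subset_univ, by rw [h]⟩

namespace OutputSystem

variable {n : ℕ} {Y : Type*} {S : OutputSystem n Y}

theorem witnessed_eq_sup (ℓ H : ℕ) {N : ℕ} (x : Fin N → S.D) :
    S.witnessed ℓ H x = Finset.univ.sup fun i => {w | Exhibits (S.trajectory H (x i)) w} := by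
  ext w
  simp [witnessed, Finset.sup_set_eq_biUnion]

/-- The exhibited set depends only on the length-H output, so the preimage is a finite union of
classes. -/
theorem measurableSet_exhibited_eq [Finite Y]
    (hmeas : ∀ (l : ℕ) (y : Fin l → Y), MeasurableSet (S.eqClass y)) (ℓ H : ℕ)
    (a : Set (Fin ℓ → Y)) :
    MeasurableSet ((fun x : S.D => {w | Exhibits (S.trajectory H x) w}) ⁻¹' {a}) := by
  have : (fun x : S.D => {w : Fin ℓ → Y | Exhibits (S.trajectory H x) w}) ⁻¹' {a} =
      ⋃ y ∈ {y : Fin H → Y | {w : Fin ℓ → Y | Exhibits y w} = a}, S.eqClass y := by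
    ext x
    simp only [Set.mem_preimage, Set.mem_singleton_iff, Set.mem_iUnion, Set.mem_ofPred_eq]
    constructor
    · exact fun h => ⟨_, h, fun j => rfl⟩
    · rintro ⟨y, rfl, hy⟩
      rw [show y = S.trajectory H x from funext hy]
  rw [this]
  exact Set.Finite.measurableSet_biUnion (Set.toFinite _) fun y _ => hmeas H y

/-- If, for all samples satisfying `Q`, a trajectory whose exhibited sequences are all witnessed
has only witnessed windows, then the abstractions built from samples satisfying `Q` enjoy the
scenario guarantee. -/
theorem one_sub_le_measureReal_inclusionProb [Fintype Y]
    (hS : S.embedding.NonBlocking) (P : Measure S.D) [IsProbabilityMeasure P]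
    (hmeas : ∀ (l : ℕ) (y : Fin l → Y), MeasurableSet (S.eqClass y)) (ℓ : ℕ) [NeZero ℓ]
    (N H : ℕ) {β : ℝ} (hβ : β ∈ Set.Ioo (0 : ℝ) 1) (Q : (Fin N → S.D) → Prop)
    (hQ : ∀ z, Q z → ∀ x, {w | Exhibits (S.trajectory H x) w} ⊆ S.witnessed ℓ H z →
      ∀ k, S.window ℓ x k ∈ S.witnessed ℓ H z) :
    1 - β ≤ (Measure.pi fun _ : Fin N => P).real
      {z | Q z → 1 - scenarioBound (complexity fun i => S.scenario ℓ H (z i)) β N ≤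
          S.inclusionProb P (S.dataDriven ℓ H z)} := by
  have : Nonempty Y := ⟨S.h 0⟩
  set μ := Measure.pi fun _ : Fin N => P
  set A : S.D → Set (Fin ℓ → Y) := fun x => {w | Exhibits (S.trajectory H x) w} with hA
  have hAm : ∀ a, MeasurableSet (A ⁻¹' {a}) := measurableSet_exhibited_eq hmeas ℓ H
  set B : Set (Fin N → S.D) := {z | P.real {x | A x ≤ Finset.univ.sup fun i => A (z i)} <
    1 - scenarioBound (coverNumber fun i => A (z i)) β N}
  have hB : μ.real B ≤ β := measureReal_lt_one_sub_scenarioBound_le P hAm hβ.1 hβ.2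
  -- B depends on the sample only through finitely many values of A. Its measurability allows
  -- passing to the complement; the guarantee event itself is reached by monotonicity alone.
  have hBm : MeasurableSet B := measurableSet_preimage_comp (e := id) hAm
    {b | P.real {x | A x ≤ Finset.univ.sup b} < 1 - scenarioBound (coverNumber b) β N}
  have hBc : 1 - β ≤ μ.real Bᶜ := by
    rw [probReal_compl_eq_one_sub hBm]
    linarith
  refine hBc.trans (measureReal_mono ?_)
  intro z hz hQz
  have hz : 1 - scenarioBound (coverNumber fun i => A (z i)) β N ≤
    P.real {x | A x ≤ Finset.univ.sup fun i => A (z i)} := not_lt.1 hz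
  rw [complexity_eq_coverNumber (A := fun i => A (z i)) fun i => by
    funext w; by_cases h : Exhibits (S.trajectory H (z i)) w <;> simp [scenario, hA, h]]
  refine hz.trans (measureReal_mono fun x hx => ?_)
  change S.embedding.behavioursFrom x ⊆ _
  rw [behavioursFrom_embedding hS, Set.singleton_subset_iff]
  exact output_mem_behaviours_domino x (hQ z hQz x (by rw [witnessed_eq_sup]; exact hx))

end OutputSystem

theorem mainTheorem3 {n : ℕ} {Y : Type*} [Fintype Y] (S : OutputSystem n Y)
    -- the concrete system is non-blocking
    (hS : S.embedding.NonBlocking)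
    -- the initial state is drawn from `P`, and the classes of output sequences are events
    (P : Measure S.D) [IsProbabilityMeasure P]
    (hmeas : ∀ (l : ℕ) (y : Fin l → Y), MeasurableSet (S.eqClass y))
    -- the strongest `ℓ`-complete abstraction of the concrete system is deterministic
    (ℓ : ℕ) [NeZero ℓ] (hdet : (S.embedding.strongestComplete ℓ).Deterministic)
    (N H : ℕ) (β : ℝ) (hβ : β ∈ Set.Ioo (0 : ℝ) 1) :
    (H = Fintype.card Y ^ (ℓ - 1) + ℓ - 1 →
      1 - β ≤ (Measure.pi fun _ : Fin N => P).real
        {x | 1 - scenarioBound (complexity fun i => S.scenario ℓ H (x i)) β N ≤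
          S.inclusionProb P (S.dataDriven ℓ H x)}) ∧
    (ℓ ≤ H → H < Fintype.card Y ^ (ℓ - 1) + ℓ - 1 →
      1 - β ≤ (Measure.pi fun _ : Fin N => P).real
        {x | (S.dataDriven ℓ H x).NonBlocking →
          1 - scenarioBound (complexity fun i => S.scenario ℓ H (x i)) β N ≤
            S.inclusionProb P (S.dataDriven ℓ H x)}) := by
  constructor
  · intro hH
    simpa using OutputSystem.one_sub_le_measureReal_inclusionProb hS P hmeas ℓ N H hβ
      (fun _ => True) fun z _ x hx => OutputSystem.window_mem_of_forall_exhibits hS hdet hH hx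
  · exact fun hH _ => OutputSystem.one_sub_le_measureReal_inclusionProb hS P hmeas ℓ N H hβ _
      fun z hz x hx => OutputSystem.window_mem_of_nonBlocking hS hdet hH hz hx
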